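/- Fix an acceptable (Gödel) numbering $(\varphi_e)_{e\in\mathbb N}$ of the partial computable functions $\mathbb N\to\mathbb N$ and put $W_e=\operatorname{dom}(\varphi_e)$. A *language* is a computably enumerable set $L\subseteq\mathbb N$. A *text* is a total function $T\colon\mathbb N\to\mathbb N\cup\{\#\}$; its content is $\operatorname{content}(T)=\operatorname{range}(T)\setminus\{\#\}$, and likewise for finite sequences; $T$ is a text of $L$ if $\operatorname{content}(T)=L$; and $T[n]=(T(0),\dots,T(n-1))$. A *learner* is a partial computable function $h\colon\mathbb N\to\mathbb N$, where finite sequences over $\mathbb N\cup\{\#\}$ and finite subsets of $\mathbb N$ are coded effectively as natural numbers. On a text $T$, a learner $h$ produces the (possibly partial) sequence of hypotheses $p(i)=h(T[i])$ if it is used as a Gold-style learner ($\mathbf G$), and $p(i)=h(\operatorname{content}(T[i]))$ if it is used as a set-driven learner ($\mathbf{Sd}$). For a total sequence $p\colon\mathbb N\to\mathbb N$ and a text $T$ define - $\mathbf{Bc}(p,T)$ (behaviourally correct): there is $n_0$ such that $W_{p(n)}=\operatorname{content}(T)$ for all $n\ge n_0$; - $\mathbf{SemConv}(p,T)$ (semantically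 conservative): for all $n<m$, if $\operatorname{content}(T[m])\subseteq W_{p(n)}$, then $W_{p(n)}=W_{p(m)}$; - $\mathbf{SemWb}(p,T)$ (semantically witness-based): for all $n,m$, if $W_{p(n)}\ne W_{p(k)}$ for some $k$ with $n\le k\le m$, then $(\operatorname{content}(T[m])\cap W_{p(m)})\setminus W_{p(n)}\neq\emptyset$. For a sequence $p$ that is not total, each of these three conditions is false. Let $[\tau(\mathbf{SemWb})\mathbf{TxtSdBc}]$ be the set of all classes $\mathcal L$ of languages for which there is a learner $h$ which, used as a set-driven learner, satisfies $\mathbf{SemWb}$ on every text whatsoever and satisfies $\mathbf{Bc}$ on every text of every $L\in\mathcal L$. Let $[\mathbf{TxtGSemConvBc}]$ be the set of all classes $\mathcal L$ of languages for which there is a learner $h$ which, used as a Gold-style learner, satisfies both $\mathbf{SemConv}$ and $\mathbf{Bc}$ on every text of every $L\in\mathcal L$ (with no condition on other texts, where $h$ may even be undefined). **Theorem.** $[\tau(\mathbf{SemWb})\mathbf{TxtSdBc}]=[\mathbf{TxtGSemConvBc}]$. -/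

import Mathlib

namespace LimitLearning

/-- `W e` is the domain of the `e`-th partial computable function, in Mathlib's effective
numbering of the partial computable functions by codes. -/
def W (e : ℕ) : Set ℕ :=
  {x | ((Denumerable.ofNat Nat.Partrec.Code e).eval x).Dom}

/-- A language is a computably enumerable set of natural numbers. -/
def IsLanguage (L : Set ℕ) : Prop :=
  REPred fun x => x ∈ L

/-- Finite sequences over the natural numbers and the pause symbol; `none` is the pause symbol. -/
abbrev FinSeq : Type := List (Option ℕ)

/-- The content of a finite sequence: the numbers occurring in it, without the pause symbol. -/
def FinSeq.content (σ : FinSeq) : Finset ℕ :=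
  σ.reduceOption.toFinset

/-- A text is a total function into the natural numbers and the pause symbol `none`. -/
abbrev Text : Type := ℕ → Option ℕ

/-- The content of a text: the numbers occurring in it, without the pause symbol. -/
def Text.content (T : Text) : Set ℕ :=
  {x | ∃ n, T n = some x}

/-- The initial sequence `(T 0, …, T (n - 1))` of length `n`. -/
def Text.initial (T : Text) (n : ℕ) : FinSeq :=
  (List.range n).map T

/-- The partial computable functions on the natural numbers, which are the (partial) learners. -/
def PartialComputable : Set (ℕ →. ℕ) :=
  {h | Nat.Partrec h}

/-- A sequence interaction function: the (coded) information which a learner receives when a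
finite sequence has been presented. -/
abbrev SeqInteraction : Type := FinSeq → ℕ

/-- Gold-style (full-information) learning: the learner receives the whole sequence,
by its standard code. -/
def Gold : SeqInteraction := fun σ => Encodable.encode σ

/-- Set-driven learning: the learner receives exactly the content of the sequence. A finite set is
coded by the standard code of the list of its elements in increasing order. -/
def SetDriven : SeqInteraction := fun σ =>
  Encodable.encode (σ.content.sort (· ≤ ·))

/-- The interaction operator given by `β`: the possibly partial sequence of hypotheses which
the learner `h` outputs on the text `T`. -/
def interact (β : SeqInteraction) (h : ℕ →. ℕ) (T : Text) : ℕ →. ℕ :=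
  fun i => h (β (T.initial i))

/-- Learning restrictions, as predicates on a possibly partial learning sequence and a text. All
restrictions below except the trivial one demand that the learning sequence is total. -/
abbrev Restriction : Type := (ℕ →. ℕ) → Text → Prop

/-- The restriction given by a predicate on total learning sequences:
the learning sequence is total and the predicate holds. -/
def onTotal (P : (ℕ → ℕ) → Text → Prop) : Restriction := fun p T =>
  ∃ q : ℕ → ℕ, (∀ n, q n ∈ p n) ∧ P q T

/-- The absence of a restriction. -/
def NoRestriction : Restriction := fun _ _ => True

/-- Both restrictions at once. -/
def Both (δ δ' : Restriction) : Restriction := fun p T => δ p T ∧ δ' p T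

/-- Behaviourally correct learning: from some point on, all hypotheses describe the content of
the text. -/
def Bc : Restriction := onTotal fun p T =>
  ∃ n₀, ∀ n, n₀ ≤ n → W (p n) = T.content

/-- Semantically conservative learning. -/
def SemConv : Restriction := onTotal fun p T =>
  ∀ n m, n < m → ((T.initial m).content : Set ℕ) ⊆ W (p n) → W (p n) = W (p m)

/-- Semantically witness-based learning. -/
def SemWb : Restriction := onTotal fun p T =>
  ∀ n m, (∃ k, n ≤ k ∧ k ≤ m ∧ W (p n) ≠ W (p k)) →
    ((((T.initial m).content : Set ℕ) ∩ W (p m)) \ W (p n)).Nonempty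

/-- The languages learned by `h` under the learning criterion which requires `α` on arbitrary texts
and `δ` on the texts of the language. -/
def learnedBy (α : Restriction) (β : SeqInteraction) (δ : Restriction) (h : ℕ →. ℕ) :
    Set (Set ℕ) :=
  {L | IsLanguage L ∧ (∀ T : Text, α (interact β h T) T) ∧
    ∀ T : Text, T.content = L → δ (interact β h T) T}

/-- The learning power of the criterion with global restriction `α`, admissible learners `C`,
interaction operator `β` and restriction `δ`: all classes of languages all of whose members are
learned by one and the same admissible learner. -/
def learningPower (α : Restriction) (C : Set (ℕ →. ℕ)) (β : SeqInteraction) (δ : Restriction) :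
    Set (Set (Set ℕ)) :=
  {𝓛 | ∃ h ∈ C, 𝓛 ⊆ learnedBy α β δ h}

end LimitLearning

/-! A Gold-style learner can sort the content it has seen, and a witness for a change of hypothesis
rules out a violation of conservativeness; this gives one inclusion. For the other, order-sensitive
hypotheses must be turned into hypotheses on finite sets that behave well on every text, even where
the given learner fails.

Run the given learner on pause-free lists and make claims in stages. An increasing list `R`, the
root, reserves all finite sets between `R` and a finite extent: `R`, the numbers above `R` that its
hypothesis has enumerated so far, and, recursively, the extents of older claims whose roots extend
`R` and are covered. A root must not be reserved already by another root, and before claiming again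
its hypothesis must have enumerated all its earlier extents, since closing up may have added foreign
numbers. The new hypothesis on `D` is `D` with the extents of all confirmed claims that reserve `D`.

Among claims reserving `D`, the ones with the shortest root form a chain and absorb the others.
Hence the new hypotheses are conservative on all finite sets, whatever the given learner does
(`hypothesis_eq_of_subset`); as they are also consistent, they are witness-based on every text.

Correctness uses conservativeness of the given learner on texts of `L`. Finite `L` is immediate
(`hypothesis_eq_of_finite`). For infinite `L`, the increasing enumeration reaches a list on which
the learner is correct, and correctness persists on extensions in `L`. Each of the finitely many
initial parts with a wrong hypothesis stops reserving once enough of `L` is seen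
(`exists_forall_locks`). Some correct root is then reserved by no other root
(`exists_unblocked_root`), and its claims exhaust `L` (`exists_claim_of_unblocked`). -/

/-! ### Primitive recursive predicates on lists -/

/-- Universal quantification over a primitive recursive list. -/
theorem PrimrecPred.forall_mem_of_primrec {α β : Type*} [Primcodable α] [Primcodable β]
    {f : α → List β} {p : α → β → Prop} (hf : Primrec f) (hp : PrimrecRel p) :
    PrimrecPred fun a => ∀ b ∈ f a, p a b :=
  (PrimrecRel.forall_mem_list (R := fun b a => p a b) hp.swap).comp hf Primrec.id

/-- Existential quantification over a primitive recursive list. -/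
theorem PrimrecPred.exists_mem_of_primrec {α β : Type*} [Primcodable α] [Primcodable β]
    {f : α → List β} {p : α → β → Prop} (hf : Primrec f) (hp : PrimrecRel p) :
    PrimrecPred fun a => ∃ b ∈ f a, p a b :=
  (PrimrecRel.exists_mem_list (R := fun b a => p a b) hp.swap).comp hf Primrec.id

/-- Filtering a primitive recursive list. -/
theorem Primrec.filter_of_primrec {α β : Type*} [Primcodable α] [Primcodable β]
    {f : α → List β} {p : α → β → Prop} [∀ a b, Decidable (p a b)] (hf : Primrec f)
    (hp : PrimrecRel p) : Primrec fun a => (f a).filter fun b => decide (p a b) :=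
  (PrimrecRel.listFilter (R := fun b a => p a b) hp.swap).comp hf Primrec.id

theorem PrimrecPred.imp {α : Type*} [Primcodable α] {p q : α → Prop} (hp : PrimrecPred p)
    (hq : PrimrecPred q) : PrimrecPred fun a => p a → q a :=
  (hp.not.or hq).of_eq fun a => by rw [imp_iff_not_or]

theorem Primrec.list_mem {α β : Type*} [Primcodable α] [Primcodable β] {f : α → β}
    {g : α → List β} (hf : Primrec f) (hg : Primrec g) : PrimrecPred fun a => f a ∈ g a :=
  (PrimrecPred.exists_mem_of_primrec (p := fun a b => b = f a) hg
    (Primrec.eq.comp Primrec.snd (hf.comp Primrec.fst))).of_eq fun a => by simp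

theorem Primrec.list_subset {α β : Type*} [Primcodable α] [Primcodable β] {f g : α → List β}
    (hf : Primrec f) (hg : Primrec g) : PrimrecPred fun a => f a ⊆ g a :=
  PrimrecPred.forall_mem_of_primrec (p := fun a b => b ∈ g a) hf
    (Primrec.list_mem Primrec.snd (hg.comp Primrec.fst))

theorem Primrec.list_prefix {α β : Type*} [Primcodable α] [Primcodable β] {f g : α → List β}
    (hf : Primrec f) (hg : Primrec g) : PrimrecPred fun a => f a <+: g a :=
  (Primrec.eq.comp hf (Primrec.list_take.comp (Primrec.list_length.comp hf) hg)).of_eq fun _ =>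
    List.prefix_iff_eq_take.symm

/-! ### Increasing lists as codes of finite sets -/

namespace LimitLearning

open List

/-- The increasing list of the elements of a list. -/
def increasing (l : List ℕ) : List ℕ :=
  (List.range (l.foldr max 0 + 1)).filter (· ∈ l)

theorem le_foldr_max {l : List ℕ} {x : ℕ} (hx : x ∈ l) : x ≤ l.foldr max 0 := by
  induction l with
  | nil => simp at hx
  | cons a l ih =>
    rcases List.mem_cons.1 hx with rfl | h
    · exact le_max_left _ _
    · exact (ih h).trans (le_max_right _ _)

@[simp]
theorem mem_increasing {l : List ℕ} {x : ℕ} : x ∈ increasing l ↔ x ∈ l := by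
  simp only [increasing, List.mem_filter, List.mem_range, decide_eq_true_eq, and_iff_right_iff_imp]
  exact fun h => Nat.lt_succ_of_le (le_foldr_max h)

theorem sortedLT_increasing (l : List ℕ) : (increasing l).SortedLT :=
  (List.pairwise_lt_range.filter _).sortedLT

theorem increasing_eq_iff {l : List ℕ} : increasing l = l ↔ l.SortedLT :=
  ⟨fun h => h ▸ sortedLT_increasing l, fun h =>
    (sortedLT_increasing l).eq_of_mem_iff h fun _ => mem_increasing⟩

theorem primrec_increasing : Primrec increasing := by
  refine Primrec.filter_of_primrec (p := fun (l : List ℕ) x => x ∈ l) ?_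
    (Primrec.list_mem Primrec.snd Primrec.fst)
  exact Primrec.list_range.comp (Primrec.succ.comp
    (Primrec.list_foldr Primrec.id (Primrec.const 0)
      (Primrec.nat_max.comp (Primrec.fst.comp Primrec.snd) (Primrec.snd.comp Primrec.snd)).to₂))

/-- An increasing list is an initial part of a larger one if the new elements are above it. -/
theorem isPrefix_of_sortedLT {R D : List ℕ} (hR : R.SortedLT) (hD : D.SortedLT) (h : R ⊆ D)
    (hlt : ∀ x ∈ D, x ∈ R ∨ ∀ y ∈ R, y < x) : R <+: D := by
  have key : D = R ++ D.filter (· ∉ R) := by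
    refine hD.eq_of_mem_iff ?_ fun x => ?_
    · refine List.Pairwise.sortedLT (List.pairwise_append.2
        ⟨hR.pairwise, hD.pairwise.filter _, fun a ha b hb => ?_⟩)
      simp only [List.mem_filter, decide_eq_true_eq] at hb
      exact (hlt b hb.1).resolve_left hb.2 a ha
    · by_cases hx : x ∈ R
      · simp [hx, h hx]
      · simp [hx]
  exact ⟨_, key.symm⟩

theorem mem_or_lt_of_isPrefix {R D : List ℕ} (hD : D.SortedLT) (h : R <+: D) {x : ℕ} (hx : x ∈ D) :
    x ∈ R ∨ ∀ y ∈ R, y < x := by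
  obtain ⟨t, rfl⟩ := h
  rcases List.mem_append.1 hx with h | h
  · exact .inl h
  · exact .inr fun y hy => (List.pairwise_append.1 hD.pairwise).2.2 y hy x h

theorem sortedLT_of_isPrefix {R D : List ℕ} (hD : D.SortedLT) (h : R <+: D) : R.SortedLT :=
  (hD.pairwise.sublist h.sublist).sortedLT

end LimitLearning

/-! ### The staged construction of claims -/

namespace LimitLearning

open List

/-- A claim consists of a root, which is an increasing list, and of its extent: all finite sets
between the root and the extent have to follow the root. -/
abbrev Claim : Type := List ℕ × List ℕ

/-- `C` contains the extents of all claims whose root is between `R` and `C`. -/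
def ClosedFor (S : List Claim) (R : List ℕ) (C : Set ℕ) : Prop :=
  ∀ p ∈ S, R <+: p.1 → (∀ x ∈ p.1, x ∈ C) → ∀ x ∈ p.2, x ∈ C

open Classical in
/-- Add to `C` the extents of all claims whose root is between `R` and `C`. -/
noncomputable def closeStep (S : List Claim) (R C : List ℕ) : List ℕ :=
  C ++ (S.filter fun p => decide (R <+: p.1 ∧ p.1 ⊆ C)).flatMap Prod.snd

/-- The least list that includes `B` and is closed under the claims in `S` with root above `R`. -/
noncomputable def closeUp (S : List Claim) (R B : List ℕ) : List ℕ :=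
  (closeStep S R)^[S.length] B

theorem mem_closeStep {S : List Claim} {R C : List ℕ} {x : ℕ} :
    x ∈ closeStep S R C ↔ x ∈ C ∨ ∃ p ∈ S, R <+: p.1 ∧ p.1 ⊆ C ∧ x ∈ p.2 := by
  simp [closeStep, and_assoc]

theorem subset_closeStep (S : List Claim) (R C : List ℕ) : C ⊆ closeStep S R C :=
  fun _ hx => mem_closeStep.2 (.inl hx)

theorem subset_closeStep_iterate (S : List Claim) (R B : List ℕ) (n : ℕ) :
    B ⊆ (closeStep S R)^[n] B := by
  induction n with
  | zero => exact List.Subset.refl _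
  | succ n ih =>
    rw [Function.iterate_succ_apply']
    exact List.Subset.trans ih (subset_closeStep _ _ _)

theorem subset_closeUp (S : List Claim) (R B : List ℕ) : B ⊆ closeUp S R B :=
  subset_closeStep_iterate S R B _

theorem closeUp_subset {S : List Claim} {R B : List ℕ} {Q : Set ℕ} (hB : ∀ x ∈ B, x ∈ Q)
    (hQ : ClosedFor S R Q) : ∀ x ∈ closeUp S R B, x ∈ Q := by
  suffices ∀ n, ∀ x ∈ (closeStep S R)^[n] B, x ∈ Q from this _
  intro n
  induction n with
  | zero => exact hB
  | succ n ih =>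
    rw [Function.iterate_succ_apply']
    intro x hx
    rcases mem_closeStep.1 hx with h | ⟨p, hp, hRp, hpC, hxp⟩
    · exact ih x h
    · exact hQ p hp hRp (fun y hy => ih y (hpC hy)) x hxp

open Classical in
theorem closedFor_closeUp (S : List Claim) (R B : List ℕ) :
    ClosedFor S R {x | x ∈ closeUp S R B} := by
  set C : ℕ → List ℕ := fun n => (closeStep S R)^[n] B with hC
  have hsucc (n : ℕ) : C (n + 1) = closeStep S R (C n) := Function.iterate_succ_apply' _ _ _
  -- The number of extents not yet absorbed drops at every step from a list that is not closed, so
  -- `S.length` steps suffice.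
  let f : ℕ → ℕ := fun n => (S.toFinset.filter fun p => ¬ p.2 ⊆ C n).card
  have key (n : ℕ) : ClosedFor S R {x | x ∈ C n} ∨ f n + n ≤ S.length := by
    induction n with
    | zero =>
      exact .inr ((Finset.card_le_card (Finset.filter_subset _ _)).trans (List.toFinset_card_le S))
    | succ n ih =>
      by_cases h : ClosedFor S R {x | x ∈ C n}
      · left
        have hsub : C (n + 1) ⊆ C n := by
          intro x hx
          rw [hsucc] at hx
          rcases mem_closeStep.1 hx with h' | ⟨p, hp, hRp, hpC, hxp⟩
          · exact h'
          · exact h p hp hRp hpC x hxp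
        intro p hp hRp hpC x hxp
        have := h p hp hRp (fun y hy => hsub (hpC y hy)) x hxp
        change x ∈ C (n + 1)
        rw [hsucc]
        exact subset_closeStep _ _ _ this
      · right
        have hf := ih.resolve_left h
        simp only [ClosedFor, not_forall] at h
        obtain ⟨p, hp, hRp, hpC, x, hxp, hx⟩ := h
        have hlt : f (n + 1) < f n := by
          refine Finset.card_lt_card ⟨fun q hq => ?_, fun hsub => ?_⟩
          · simp only [Finset.mem_filter] at hq ⊢
            refine ⟨hq.1, fun h => hq.2 (List.Subset.trans h ?_)⟩
            rw [hsucc]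
            exact subset_closeStep _ _ _
          · have hpf := hsub (Finset.mem_filter.2
              ⟨List.mem_toFinset.2 hp, fun h => hx (h hxp)⟩)
            refine (Finset.mem_filter.1 hpf).2 fun y hy => ?_
            rw [hsucc]
            exact mem_closeStep.2 (.inr ⟨p, hp, hRp, hpC, hy⟩)
        omega
  rcases key S.length with h | h
  · exact h
  · intro p hp _ _ x hxp
    by_contra hx
    have : 0 < f S.length := Finset.card_pos.2 ⟨p, Finset.mem_filter.2
      ⟨List.mem_toFinset.2 hp, fun h => hx (h hxp)⟩⟩
    omega

theorem primrec_closeUp {α : Type*} [Primcodable α] {S : α → List Claim} {R B : α → List ℕ}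
    (hS : Primrec S) (hR : Primrec R) (hB : Primrec B) :
    Primrec fun a => closeUp (S a) (R a) (B a) := by
  classical
  refine Primrec.nat_iterate (Primrec.list_length.comp hS) hB ?_
  refine Primrec.list_append.comp Primrec.snd (Primrec.list_flatMap ?_ ?_)
  · refine Primrec.filter_of_primrec
      (p := fun (x : α × List ℕ) (q : Claim) => R x.1 <+: q.1 ∧ q.1 ⊆ x.2)
      (hS.comp Primrec.fst) ?_
    exact (Primrec.list_prefix (hR.comp (Primrec.fst.comp Primrec.fst))
      (Primrec.fst.comp Primrec.snd)).and (Primrec.list_subset (Primrec.fst.comp Primrec.snd)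
      (Primrec.snd.comp Primrec.fst))
  · exact (Primrec.snd.comp Primrec.snd).to₂

/-- The claim with root `R` may be renewed or made at stage `s`, if `S` are the claims so far:
no claim with another root concerns `R`, and all extents claimed by `R` have been confirmed. -/
def MayClaim (A : ℕ → List ℕ → ℕ → Prop) (s : ℕ) (S : List Claim) (R : List ℕ) : Prop :=
  R.SortedLT ∧ ∀ p ∈ S, p.1 <+: R → R ⊆ p.2 → p.1 = R ∧ ∀ x ∈ p.2, A s R x

open Classical in
/-- The numbers above `R` which the hypothesis at `R` has enumerated by stage `s`. -/
noncomputable def enumeratedAbove (A : ℕ → List ℕ → ℕ → Prop) (s : ℕ) (R : List ℕ) : List ℕ :=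
  (List.range s).filter fun x => decide (A s R x ∧ ∀ y ∈ R, y < x)

open Classical in
/-- The effect of stage `s`, in which the root `R` is considered. -/
noncomputable def nextClaims (A : ℕ → List ℕ → ℕ → Prop) (s : ℕ) (S : List Claim) (R : List ℕ) :
    List Claim :=
  if MayClaim A s S R then (R, closeUp S R (R ++ enumeratedAbove A s R)) :: S else S

/-- The root considered in stage `s`. -/
def stageRoot (s : ℕ) : List ℕ :=
  Denumerable.ofNat (List ℕ) s.unpair.1

/-- The claims made before stage `s`, the newest one first. -/
noncomputable def claims (A : ℕ → List ℕ → ℕ → Prop) : ℕ → List Claim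
  | 0 => []
  | s + 1 => nextClaims A s (claims A s) (stageRoot s)

theorem primrec_claims {A : ℕ → List ℕ → ℕ → Prop}
    (hA : PrimrecPred fun q : ℕ × List ℕ × ℕ => A q.1 q.2.1 q.2.2) : Primrec (claims A) := by
  classical
  have hroot : Primrec stageRoot :=
    (Primrec.ofNat (List ℕ)).comp (Primrec.fst.comp Primrec.unpair)
  have hnext : Primrec fun q : ℕ × List Claim => nextClaims A q.1 q.2 (stageRoot q.1) := by
    have hR : Primrec fun q : ℕ × List Claim => stageRoot q.1 := hroot.comp Primrec.fst
    refine Primrec.ite ?_ (Primrec.list_cons.comp (hR.pair (primrec_closeUp Primrec.snd hR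
      (Primrec.list_append.comp hR ?_))) Primrec.snd) Primrec.snd
    · refine PrimrecPred.and ?_ ?_
      · exact (Primrec.eq.comp (primrec_increasing.comp hR) hR).of_eq fun _ => increasing_eq_iff
      · refine PrimrecPred.forall_mem_of_primrec (f := fun q : ℕ × List Claim => q.2)
          (p := fun q p => p.1 <+: stageRoot q.1 → stageRoot q.1 ⊆ p.2 →
            p.1 = stageRoot q.1 ∧ ∀ x ∈ p.2, A q.1 (stageRoot q.1) x) Primrec.snd ?_
        have hR' : Primrec fun q : (ℕ × List Claim) × Claim => stageRoot q.1.1 :=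
          hR.comp Primrec.fst
        have h1 : Primrec fun q : (ℕ × List Claim) × Claim => q.2.1 :=
          Primrec.fst.comp Primrec.snd
        have h2 : Primrec fun q : (ℕ × List Claim) × Claim => q.2.2 :=
          Primrec.snd.comp Primrec.snd
        refine (Primrec.list_prefix h1 hR').imp ((Primrec.list_subset hR' h2).imp
          ((Primrec.eq.comp h1 hR').and ?_))
        exact PrimrecPred.forall_mem_of_primrec (f := fun q : (ℕ × List Claim) × Claim => q.2.2)
          (p := fun q x => A q.1.1 (stageRoot q.1.1) x) h2
          (hA.comp ((Primrec.fst.comp (Primrec.fst.comp Primrec.fst)).pair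
            ((hR'.comp Primrec.fst).pair Primrec.snd)))
    · refine Primrec.filter_of_primrec (f := fun q : ℕ × List Claim => List.range q.1)
        (p := fun q x => A q.1 (stageRoot q.1) x ∧ ∀ y ∈ stageRoot q.1, y < x)
        (Primrec.list_range.comp Primrec.fst) ?_
      refine PrimrecPred.and (hA.comp ((Primrec.fst.comp Primrec.fst).pair
            ((hR.comp Primrec.fst).pair Primrec.snd))) ?_
      exact PrimrecPred.forall_mem_of_primrec
        (f := fun q : (ℕ × List Claim) × ℕ => stageRoot q.1.1) (p := fun q y => y < q.2)
        (hR.comp Primrec.fst) (Primrec.nat_lt.comp Primrec.snd (Primrec.snd.comp Primrec.fst))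
  refine (Primrec.nat_rec₁ (f := fun s S => nextClaims A s S (stageRoot s)) [] hnext).of_eq
    fun s => ?_
  induction s with
  | zero => rfl
  | succ s ih => exact congrArg (fun S => nextClaims A s S (stageRoot s)) ih

end LimitLearning

/-! ### Coherence of claims and conservativeness of the new hypotheses -/

namespace LimitLearning

open List

variable {A : ℕ → List ℕ → ℕ → Prop}

/-- A claim is confirmed if the hypothesis at its root contains its extent. -/
def Confirmed (A : ℕ → List ℕ → ℕ → Prop) (p : Claim) : Prop :=
  ∀ x ∈ p.2, ∃ s, A s p.1 x

/-- The relation between a newer claim `q` and an older claim `p`. -/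
structure Coherent (A : ℕ → List ℕ → ℕ → Prop) (q p : Claim) : Prop where
  root_eq : p.1 <+: q.1 → q.1 ⊆ p.2 → p.1 = q.1
  confirmed : p.1 <+: q.1 → q.1 ⊆ p.2 → Confirmed A p
  extent_subset : q.1 <+: p.1 → p.1 ⊆ q.2 → p.2 ⊆ q.2

/-- A claim whose root is an initial part of its extent. -/
structure IsProper (p : Claim) : Prop where
  sorted : p.1.SortedLT
  root_subset : p.1 ⊆ p.2
  mem_or_lt : ∀ x ∈ p.2, x ∈ p.1 ∨ ∀ y ∈ p.1, y < x

theorem claims_subset_succ (s : ℕ) : claims A s ⊆ claims A (s + 1) := by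
  rw [claims, nextClaims]
  split_ifs
  · exact List.subset_cons_self _ _
  · exact List.Subset.refl _

theorem claims_subset_of_le {s t : ℕ} (h : s ≤ t) : claims A s ⊆ claims A t := by
  induction t, h using Nat.le_induction with
  | base => exact List.Subset.refl _
  | succ t _ ih => exact List.Subset.trans ih (claims_subset_succ t)

theorem isProper_of_mem_claims (s : ℕ) : ∀ p ∈ claims A s, IsProper p := by
  induction s with
  | zero => simp [claims]
  | succ s ih =>
    rw [claims, nextClaims]
    split_ifs with h
    · refine List.forall_mem_cons.2 ⟨⟨h.1, fun x hx => subset_closeUp _ _ _ (by simp [hx]), ?_⟩, ih⟩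
      refine closeUp_subset (Q := {x | x ∈ stageRoot s ∨ ∀ y ∈ stageRoot s, y < x}) ?_ ?_
      · intro x hx
        rcases List.mem_append.1 hx with hx | hx
        · exact .inl hx
        · simp only [enumeratedAbove, List.mem_filter, decide_eq_true_eq] at hx
          exact .inr hx.2.2
      · intro p hp hRp hpQ x hx
        rcases (ih p hp).mem_or_lt x hx with hx | hx
        · exact hpQ x hx
        · exact .inr fun y hy => hx y (hRp.subset hy)
    · exact ih

/-- The newest claim stands first. `MayClaim` gives the conditions on roots and confirmation, and
closing up the extent gives the inclusion of extents. -/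
theorem pairwise_coherent_claims (s : ℕ) : (claims A s).Pairwise (Coherent A) := by
  induction s with
  | zero => simp [claims]
  | succ s ih =>
    rw [claims, nextClaims]
    split_ifs with h
    · refine List.pairwise_cons.2 ⟨fun p hp => ⟨fun h1 h2 => (h.2 p hp h1 h2).1, ?_, ?_⟩, ih⟩
      · intro h1 h2
        obtain ⟨h3, h4⟩ := h.2 p hp h1 h2
        exact fun x hx => ⟨s, h3 ▸ h4 x hx⟩
      · exact fun h1 h2 x hx => closedFor_closeUp _ _ _ p hp h1 (fun y hy => h2 hy) x hx
    · exact ih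

/-- The claims made in any stage. -/
def allClaims (A : ℕ → List ℕ → ℕ → Prop) : Set Claim :=
  {p | ∃ s, p ∈ claims A s}

theorem isProper_of_mem_allClaims {p : Claim} (hp : p ∈ allClaims A) : IsProper p :=
  hp.elim fun s => isProper_of_mem_claims s p

theorem coherent_of_mem_allClaims {p q : Claim} (hp : p ∈ allClaims A) (hq : q ∈ allClaims A) :
    p = q ∨ Coherent A p q ∨ Coherent A q p := by
  obtain ⟨s, hs⟩ := hp
  obtain ⟨t, ht⟩ := hq
  by_cases hpq : p = q
  · exact .inl hpq
  · let R : Claim → Claim → Prop := fun p q => Coherent A p q ∨ Coherent A q p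
    have : Std.Symm R := ⟨fun _ _ h => h.symm⟩
    have hR : (claims A (max s t)).Pairwise R := (pairwise_coherent_claims _).imp Or.inl
    exact .inr (hR.forall (claims_subset_of_le (le_max_left s t) hs)
      (claims_subset_of_le (le_max_right s t) ht) hpq)

/-- Two claims at the same root are comparable. -/
theorem extent_subset_or_subset {p q : Claim} (hp : p ∈ allClaims A) (hq : q ∈ allClaims A)
    (h : p.1 = q.1) : p.2 ⊆ q.2 ∨ q.2 ⊆ p.2 := by
  have hp' := (isProper_of_mem_allClaims hp).root_subset
  have hq' := (isProper_of_mem_allClaims hq).root_subset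
  rcases coherent_of_mem_allClaims hp hq with rfl | hc | hc
  · exact .inl (List.Subset.refl _)
  · exact .inr (hc.extent_subset (h ▸ List.prefix_refl _) (h ▸ hp'))
  · exact .inl (hc.extent_subset (h ▸ List.prefix_refl _) (h ▸ hq'))

/-- At each root, at most one claim is not confirmed. -/
theorem eq_of_not_confirmed {p q : Claim} (hp : p ∈ allClaims A) (hq : q ∈ allClaims A)
    (h : p.1 = q.1) (hp' : ¬ Confirmed A p) (hq' : ¬ Confirmed A q) : p = q := by
  have hps := (isProper_of_mem_allClaims hp).root_subset
  have hqs := (isProper_of_mem_allClaims hq).root_subset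
  rcases coherent_of_mem_allClaims hp hq with hc | hc | hc
  · exact hc
  · exact absurd (hc.confirmed (h ▸ List.prefix_refl _) (h ▸ hqs)) hq'
  · exact absurd (hc.confirmed (h ▸ List.prefix_refl _) (h ▸ hps)) hp'

/-- A claim concerns the sets between its root and its extent; they follow confirmed claims. -/
structure Concerns (A : ℕ → List ℕ → ℕ → Prop) (p : Claim) (D : List ℕ) : Prop where
  mem : p ∈ allClaims A
  isPrefix : p.1 <+: D
  subset : D ⊆ p.2
  confirmed : Confirmed A p

/-- The set hypothesized on the finite set `D`: its elements and the extents of the confirmed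
claims which concern it. -/
def hypothesis (A : ℕ → List ℕ → ℕ → Prop) (D : List ℕ) : Set ℕ :=
  {x | x ∈ D ∨ ∃ p, Concerns A p D ∧ x ∈ p.2}

/-- If a confirmed claim with longer root concerns the same set, then either it has the same root
or it is subsumed. -/
theorem Concerns.root_eq_or_subset {p q : Claim} {D : List ℕ} (hp : Concerns A p D)
    (hq : Concerns A q D) (h : q.1 <+: p.1) : p.1 = q.1 ∨ p.2 ⊆ q.2 := by
  have hpq : p.1 ⊆ q.2 := List.Subset.trans hp.isPrefix.subset hq.subset
  rcases coherent_of_mem_allClaims hp.mem hq.mem with rfl | hc | hc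
  · exact .inl rfl
  · exact .inl (hc.root_eq h hpq).symm
  · exact .inr (hc.extent_subset h hpq)

/-- Extents add only numbers above the root, so the root remains an initial part of the larger
increasing list. This is why claims ignore enumerated numbers below the maximum of the root. -/
theorem Concerns.mono {p : Claim} {D D' : List ℕ} (hp : Concerns A p D) (hD' : D'.SortedLT)
    (h : D ⊆ D') (h' : D' ⊆ p.2) : Concerns A p D' :=
  ⟨hp.mem, isPrefix_of_sortedLT (isProper_of_mem_allClaims hp.mem).sorted hD'
    (List.Subset.trans hp.isPrefix.subset h)
    fun x hx => (isProper_of_mem_allClaims hp.mem).mem_or_lt x (h' hx), h', hp.confirmed⟩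

/-- If a set is concerned by a claim at all, then any finite part of its hypothesis is contained in
the extent of a claim with the shortest root. -/
theorem exists_concerns_of_subset {D : List ℕ} {p₀ : Claim} (h₀ : Concerns A p₀ D)
    (hmin : ∀ p, Concerns A p D → p₀.1.length ≤ p.1.length) (X : List ℕ)
    (hX : ∀ x ∈ X, x ∈ hypothesis A D) :
    ∃ q, Concerns A q D ∧ q.1 = p₀.1 ∧ X ⊆ q.2 := by
  induction X with
  | nil => exact ⟨p₀, h₀, rfl, List.nil_subset _⟩
  | cons x X ih =>
    obtain ⟨q, hq, hq₀, hXq⟩ := ih fun y hy => hX y (List.mem_cons_of_mem _ hy)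
    have : ∃ r, Concerns A r D ∧ r.1 = p₀.1 ∧ x ∈ r.2 := by
      rcases hX x List.mem_cons_self with hx | ⟨p, hp, hx⟩
      · exact ⟨p₀, h₀, rfl, h₀.subset hx⟩
      · rcases hp.root_eq_or_subset h₀
          (List.prefix_of_prefix_length_le h₀.isPrefix hp.isPrefix (hmin p hp)) with h | h
        · exact ⟨p, hp, h, hx⟩
        · exact ⟨p₀, h₀, rfl, h hx⟩
    obtain ⟨r, hr, hr₀, hxr⟩ := this
    rcases extent_subset_or_subset hq.mem hr.mem (hq₀.trans hr₀.symm) with h | h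
    · exact ⟨r, hr, hr₀, List.cons_subset.2 ⟨hxr, List.Subset.trans hXq h⟩⟩
    · exact ⟨q, hq, hq₀, List.cons_subset.2 ⟨h hxr, hXq⟩⟩

theorem subset_hypothesis {D : List ℕ} {x : ℕ} (hx : x ∈ D) : x ∈ hypothesis A D :=
  .inl hx

/-- The hypotheses are semantically conservative on all finite sets. -/
theorem hypothesis_eq_of_subset {D D' : List ℕ} (hD : D.SortedLT) (hD' : D'.SortedLT)
    (h : D ⊆ D') (h' : ∀ x ∈ D', x ∈ hypothesis A D) : hypothesis A D' = hypothesis A D := by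
  by_cases hex : ∃ p, Concerns A p D
  · obtain ⟨p₀, h₀, hmin⟩ : ∃ p₀, Concerns A p₀ D ∧
        ∀ p, Concerns A p D → p₀.1.length ≤ p.1.length := by
      obtain ⟨p₀, h₀, hmin⟩ := WellFounded.has_min
        (InvImage.wf (fun p : Claim => p.1.length) Nat.lt_wfRel.wf) {p | Concerns A p D} hex
      exact ⟨p₀, h₀, fun p hp => not_lt.1 (hmin p hp)⟩
    obtain ⟨q, hq, hq₀, hD'q⟩ := exists_concerns_of_subset h₀ hmin D' h'
    have hqD' := hq.mono hD' h hD'q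
    refine Set.Subset.antisymm (fun x hx => ?_) fun x hx => ?_
    · rcases hx with hx | ⟨p, hp, hx⟩
      · exact h' x hx
      -- A claim with root no longer than that of `q` already concerns `D`; one with a longer root
      -- is absorbed by `q` unless the roots agree.
      · rcases le_total p.1.length q.1.length with hle | hle
        · have hpq : p.1 <+: D :=
            (List.prefix_of_prefix_length_le hp.isPrefix hqD'.isPrefix hle).trans hq.isPrefix
          exact .inr ⟨p, ⟨hp.mem, hpq, List.Subset.trans h hp.subset, hp.confirmed⟩, hx⟩
        · rcases hp.root_eq_or_subset hqD'
            (List.prefix_of_prefix_length_le hqD'.isPrefix hp.isPrefix hle) with he | he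
          · exact .inr ⟨p, ⟨hp.mem, he ▸ hq.isPrefix, List.Subset.trans h hp.subset,
              hp.confirmed⟩, hx⟩
          · exact .inr ⟨q, hq, he hx⟩
    -- One extent covering both `x` and `D'` is needed, so that its claim also concerns `D'`.
    · obtain ⟨r, hr, -, hxr⟩ := exists_concerns_of_subset h₀ hmin (x :: D')
        (List.forall_mem_cons.2 ⟨hx, h'⟩)
      rw [List.cons_subset] at hxr
      exact .inr ⟨r, hr.mono hD' h hxr.2, hxr.1⟩
  · have hDD' : D' ⊆ D := fun x hx => (h' x hx).resolve_right fun ⟨p, hp, _⟩ => hex ⟨p, hp⟩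
    rw [hD'.eq_of_mem_iff hD fun x => ⟨fun hx => hDD' hx, fun hx => h hx⟩]

end LimitLearning

/-! ### Convergence on a learned language -/

namespace LimitLearning

open List Filter

variable {A : ℕ → List ℕ → ℕ → Prop}

/-- The set enumerated by the hypothesis at the sequence `σ`. -/
def enumerated (A : ℕ → List ℕ → ℕ → Prop) (σ : List ℕ) : Set ℕ :=
  {x | ∃ s, A s σ x}

/-- The hypotheses enumerated by `A` on sequences of elements of `L` are semantically conservative,
and none of them is a proper superset of `L`. -/
structure ConservativeOn (A : ℕ → List ℕ → ℕ → Prop) (L : Set ℕ) : Prop where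
  enumerated_eq : ∀ σ τ : List ℕ, σ <+: τ → (∀ x ∈ τ, x ∈ L) → (∀ x ∈ τ, x ∈ enumerated A σ) →
    enumerated A τ = enumerated A σ
  eq_of_subset : ∀ σ : List ℕ, (∀ x ∈ σ, x ∈ L) → L ⊆ enumerated A σ → enumerated A σ = L

theorem hypothesis_eq_of_finite {L : Set ℕ} (hL : ConservativeOn A L) {D : List ℕ}
    (hD : ∀ x, x ∈ D ↔ x ∈ L) : hypothesis A D = L := by
  refine Set.Subset.antisymm (fun x hx => ?_) fun x hx => .inl ((hD x).2 hx)
  rcases hx with hx | ⟨p, hp, hx⟩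
  · exact (hD x).1 hx
  · rw [← hL.eq_of_subset p.1 (fun y hy => (hD y).1 (hp.isPrefix.subset hy))
      fun y hy => hp.confirmed y (hp.subset ((hD y).2 hy))]
    exact hp.confirmed x hx

/-- A sequence of elements of `L` on which the hypothesis is correct. -/
structure Locks (A : ℕ → List ℕ → ℕ → Prop) (L : Set ℕ) (σ : List ℕ) : Prop where
  mem : ∀ x ∈ σ, x ∈ L
  enumerated_eq : enumerated A σ = L

theorem Locks.mono {L : Set ℕ} (hL : ConservativeOn A L) {σ τ : List ℕ} (hσ : Locks A L σ)
    (h : σ <+: τ) (hτ : ∀ x ∈ τ, x ∈ L) : Locks A L τ :=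
  ⟨hτ, (hL.enumerated_eq σ τ h hτ fun x hx => hσ.enumerated_eq ▸ hτ x hx).trans hσ.enumerated_eq⟩

/-- Closing up cannot leave `L`: an absorbed claim with root in `L` extends a locking root, hence
has a locking root itself, and induction on the stage applies. -/
theorem extent_subset_of_mem_claims {L : Set ℕ} (hL : ConservativeOn A L) (s : ℕ) :
    ∀ p ∈ claims A s, Locks A L p.1 → ∀ x ∈ p.2, x ∈ L := by
  induction s with
  | zero => simp [claims]
  | succ s ih =>
    rw [claims, nextClaims]
    split_ifs with h
    · refine List.forall_mem_cons.2 ⟨fun hR => closeUp_subset ?_ ?_, ih⟩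
      · intro x hx
        rcases List.mem_append.1 hx with hx | hx
        · exact hR.mem x hx
        · simp only [enumeratedAbove, List.mem_filter, decide_eq_true_eq] at hx
          exact hR.enumerated_eq ▸ ⟨s, hx.2.1⟩
      · exact fun p hp hRp hpL => ih p hp (hR.mono hL hRp hpL)
    · exact ih

theorem Locks.extent_subset {L : Set ℕ} (hL : ConservativeOn A L) {p : Claim}
    (hp : p ∈ allClaims A) (h : Locks A L p.1) : ∀ x ∈ p.2, x ∈ L :=
  hp.elim fun s hs => extent_subset_of_mem_claims hL s p hs h

theorem Locks.confirmed {L : Set ℕ} (hL : ConservativeOn A L) {p : Claim}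
    (hp : p ∈ allClaims A) (h : Locks A L p.1) : Confirmed A p := fun x hx => by
  change x ∈ enumerated A p.1
  exact h.enumerated_eq.symm ▸ h.extent_subset hL hp x hx

theorem eventually_of_exists (hA : ∀ s t σ x, s ≤ t → A s σ x → A t σ x) {σ : List ℕ} {x : ℕ}
    (h : ∃ s, A s σ x) : ∀ᶠ s in atTop, A s σ x :=
  h.elim fun s hs => eventually_atTop.2 ⟨s, fun t hst => hA s t σ x hst hs⟩

theorem eventually_forall_mem {α : Type*} (l : List α) {Q : α → ℕ → Prop}
    (h : ∀ a ∈ l, ∀ᶠ n in atTop, Q a n) : ∀ᶠ n in atTop, ∀ a ∈ l, Q a n :=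
  (eventually_all_finite (List.finite_toSet l)).2 h

/-- A root which is concerned by no claim with another root, and at which all claims are confirmed,
claims each finite part of what it enumerates above it. -/
theorem exists_claim_of_unblocked (hA : ∀ s t σ x, s ≤ t → A s σ x → A t σ x) {R : List ℕ}
    (hR : R.SortedLT) (hroot : ∀ p ∈ allClaims A, p.1 <+: R → R ⊆ p.2 → p.1 = R)
    (hconf : ∀ p ∈ allClaims A, p.1 = R → Confirmed A p) (X : List ℕ)
    (hX : ∀ x ∈ X, x ∈ enumerated A R ∧ (x ∈ R ∨ ∀ y ∈ R, y < x)) :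
    ∃ p ∈ allClaims A, p.1 = R ∧ X ⊆ p.2 := by
  by_contra! hcon
  obtain ⟨s₁, hs₁⟩ := eventually_atTop.1 (eventually_forall_mem X fun x hx =>
    (eventually_gt_atTop x).and (eventually_of_exists hA (hX x hx).1))
  have hnew (s : ℕ) (hs : s₁ ≤ s) (S : List Claim) :
      X ⊆ closeUp S R (R ++ enumeratedAbove A s R) := by
    intro x hx
    refine subset_closeUp _ _ _ (List.mem_append.2 ?_)
    refine (hX x hx).2.imp_right fun h => ?_
    simp only [enumeratedAbove, List.mem_filter, List.mem_range, decide_eq_true_eq]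
    exact ⟨(hs₁ s hs x hx).1, (hs₁ s hs x hx).2, h⟩
  -- From `s₁` on, any new claim at `R` would cover `X`; so the claims at `R` are frozen and can all
  -- be confirmed by one stage.
  have hold (s : ℕ) (hs : s₁ ≤ s) : ∀ p ∈ claims A s, p.1 = R → p ∈ claims A s₁ := by
    induction s, hs using Nat.le_induction with
    | base => exact fun p hp _ => hp
    | succ s hs ih =>
      intro p hp hpR
      by_cases hps : p ∈ claims A s
      · exact ih p hps hpR
      · refine absurd ?_ (hcon p ⟨s + 1, hp⟩ hpR)
        rw [claims, nextClaims] at hp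
        split_ifs at hp with h
        · rcases List.mem_cons.1 hp with rfl | hp
          · dsimp only at hpR ⊢
            rw [hpR]
            exact hnew s hs _
          · exact absurd hp hps
        · exact absurd hp hps
  obtain ⟨s₂, hs₂⟩ := eventually_atTop.1 (eventually_forall_mem (claims A s₁)
    (Q := fun p s => p.1 = R → ∀ x ∈ p.2, A s R x) fun p hp => by
      by_cases hpR : p.1 = R
      · refine (eventually_forall_mem p.2 fun x hx => eventually_of_exists hA
          (hconf p ⟨s₁, hp⟩ hpR x hx)).mono fun s hs _ x hx => hpR ▸ hs x hx
      · exact .of_forall fun s h => absurd h hpR)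
  -- Every root is considered at arbitrarily late stages; this one is past both bounds.
  set s := Nat.pair (Encodable.encode R) (max s₁ s₂) with hs
  have hle : max s₁ s₂ ≤ s := Nat.right_le_pair _ _
  have hsR : stageRoot s = R := by simp [stageRoot, hs]
  have hmay : MayClaim A s (claims A s) (stageRoot s) := by
    rw [hsR]
    refine ⟨hR, fun p hp h1 h2 => ?_⟩
    have hpR := hroot p ⟨s, hp⟩ h1 h2
    exact ⟨hpR, hs₂ s ((le_max_right _ _).trans hle) p
      (hold s ((le_max_left _ _).trans hle) p hp hpR) hpR⟩
  refine hcon (R, closeUp (claims A s) R (R ++ enumeratedAbove A s R)) ⟨s + 1, ?_⟩ rfl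
    (hnew s ((le_max_left _ _).trans hle) _)
  rw [claims, nextClaims, if_pos hmay, hsR]
  exact List.mem_cons_self

/-- On an infinite set, all sufficiently large sets are concerned by claims with correct root only,
provided that the hypotheses on one increasing enumeration are eventually correct. -/
theorem exists_forall_locks {L : Set ℕ} (hL : ConservativeOn A L) (hinf : L.Infinite)
    {P : ℕ → List ℕ} (hP : ∀ m n, m ≤ n → P m <+: P n)
    (hPL : ∀ x, x ∈ L ↔ ∃ n, x ∈ P n) {n₀ : ℕ} (h₀ : enumerated A (P n₀) = L) :
    ∃ n, Locks A L (P n) ∧ (∀ σ, P n <+: σ → (∀ x ∈ σ, x ∈ L) → Locks A L σ) ∧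
      ∀ p ∈ allClaims A, p.1 <+: P n → P n ⊆ p.2 → Locks A L p.1 := by
  have hlock : Locks A L (P n₀) := ⟨fun x hx => (hPL x).2 ⟨n₀, hx⟩, h₀⟩
  have hmem {x : ℕ} (hx : x ∈ L) : ∀ᶠ n in atTop, x ∈ P n := by
    obtain ⟨m, hm⟩ := (hPL x).1 hx
    exact eventually_atTop.2 ⟨m, fun n hn => (hP m n hn).subset hm⟩
  have hbad : ∀ᶠ n in atTop, ∀ F ∈ (P n₀).inits, ∀ p ∈ allClaims A, p.1 = F → P n ⊆ p.2 →
      Locks A L F := by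
    refine eventually_forall_mem _ fun F hF => ?_
    have hFL : ∀ x ∈ F, x ∈ L := fun x hx => hlock.mem x ((List.mem_inits _ _).1 hF |>.subset hx)
    by_cases hgood : enumerated A F = L
    · exact .of_forall fun n p _ _ _ => ⟨hFL, hgood⟩
    -- A wrong hypothesis at `F` misses some `y` in `L`, so a claim at `F` covering `y` is
    -- unconfirmed. There is at most one such claim, and its finite extent misses some `z` in `L`.
    · obtain ⟨y, hyL, hy⟩ := Set.not_subset.1 fun h => hgood (hL.eq_of_subset F hFL h)
      have hconf : ∀ᶠ n in atTop, ∀ p ∈ allClaims A, p.1 = F → P n ⊆ p.2 → ¬ Confirmed A p :=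
        (hmem hyL).mono fun n hn p _ hpF hnp hp => hy (hpF ▸ hp y (hnp hn))
      by_cases hex : ∃ p ∈ allClaims A, p.1 = F ∧ ¬ Confirmed A p
      · obtain ⟨p₁, hp₁, hp₁F, hp₁c⟩ := hex
        obtain ⟨z, hzL, hz⟩ := Set.not_subset.1 fun h : L ⊆ {x | x ∈ p₁.2} =>
          hinf ((List.finite_toSet p₁.2).subset h)
        filter_upwards [hconf, hmem hzL] with n hn hzn p hp hpF hnp
        have := eq_of_not_confirmed hp hp₁ (hpF.trans hp₁F.symm) (hn p hp hpF hnp) hp₁c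
        exact absurd (hnp hzn) (this ▸ hz)
      · exact hconf.mono fun n hn p hp hpF hnp => absurd ⟨p, hp, hpF, hn p hp hpF hnp⟩ hex
  obtain ⟨n, hn, hn₀⟩ := (hbad.and (eventually_ge_atTop n₀)).exists
  have hPn : Locks A L (P n) := hlock.mono hL (hP _ _ hn₀) fun x hx => (hPL x).2 ⟨n, hx⟩
  refine ⟨n, hPn, fun σ hσ => hPn.mono hL hσ, fun p hp hpn hnp => ?_⟩
  rcases List.prefix_or_prefix_of_prefix hpn (hP _ _ hn₀) with h | h
  · exact hn p.1 ((List.mem_inits _ _).2 h) p hp rfl hnp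
  · exact hlock.mono hL h fun x hx => hPn.mem x (hpn.subset hx)

/-- If all claims which concern `σ` have correct roots, then an initial part of `σ` is a correct
root which no other root concerns. -/
theorem exists_unblocked_root {L : Set ℕ} {σ : List ℕ} (hσ : Locks A L σ)
    (h : ∀ p ∈ allClaims A, p.1 <+: σ → σ ⊆ p.2 → Locks A L p.1) :
    ∃ R, R <+: σ ∧ Locks A L R ∧ ∀ p ∈ allClaims A, p.1 <+: R → R ⊆ p.2 → p.1 = R := by
  obtain ⟨R, ⟨hRσ, hR⟩, hmin⟩ := WellFounded.has_min (InvImage.wf List.length Nat.lt_wfRel.wf)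
    {R : List ℕ | R <+: σ ∧ (R = σ ∨ ∃ p ∈ allClaims A, p.1 = R ∧ σ ⊆ p.2)}
    ⟨σ, List.prefix_refl _, .inl rfl⟩
  have heq {p : Claim} (hp : p ∈ allClaims A) (hpR : p.1 <+: R) (hσp : σ ⊆ p.2) : p.1 = R :=
    hpR.eq_of_length_le (not_lt.1 (hmin p.1 ⟨hpR.trans hRσ, .inr ⟨p, hp, rfl, hσp⟩⟩))
  refine ⟨R, hRσ, ?_, fun p hp hpR hRp => ?_⟩
  · rcases hR with rfl | ⟨p, hp, rfl, hσp⟩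
    · exact hσ
    · exact h p hp hRσ hσp
  · rcases hR with rfl | ⟨q, hq, rfl, hσq⟩
    · exact heq hp hpR hRp
    -- If `p` is newer than `q`, its extent absorbs that of `q`, hence covers `σ`, and minimality
    -- applies; if `q` is newer, it could not have been made under another root.
    · rcases coherent_of_mem_allClaims hp hq with rfl | hc | hc
      · rfl
      · exact heq hp hpR (List.Subset.trans hσq (hc.extent_subset hpR hRp))
      · exact hc.root_eq hpR hRp

/-- On an infinite set, the hypotheses converge if those on one increasing enumeration do. -/
theorem exists_hypothesis_eq (hA : ∀ s t σ x, s ≤ t → A s σ x → A t σ x) {L : Set ℕ}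
    (hL : ConservativeOn A L) (hinf : L.Infinite)
    {P : ℕ → List ℕ} (hP : ∀ m n, m ≤ n → P m <+: P n) (hsort : ∀ n, (P n).SortedLT)
    (hPL : ∀ x, x ∈ L ↔ ∃ n, x ∈ P n) {n₀ : ℕ} (h₀ : enumerated A (P n₀) = L) :
    ∃ n, ∀ D : List ℕ, D.SortedLT → P n ⊆ D → (∀ x ∈ D, x ∈ L) → hypothesis A D = L := by
  obtain ⟨n, hPn, habove, hbelow⟩ := exists_forall_locks hL hinf hP hPL h₀
  have hor {R : List ℕ} (hR : R <+: P n) {x : ℕ} (hx : x ∈ L) : x ∈ R ∨ ∀ y ∈ R, y < x := by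
    obtain ⟨m, hm⟩ := (hPL x).1 hx
    exact mem_or_lt_of_isPrefix (hsort (max m n)) (hR.trans (hP _ _ (le_max_right _ _)))
      ((hP _ _ (le_max_left _ _)).subset hm)
  obtain ⟨R, hRn, hR, hroot⟩ := exists_unblocked_root hPn hbelow
  refine ⟨n, fun D hD hnD hDL => ?_⟩
  have hPD : P n <+: D := isPrefix_of_sortedLT (hsort n) hD hnD
    fun x hx => hor (List.prefix_refl _) (hDL x hx)
  refine Set.Subset.antisymm ?_ fun x hx => ?_
  · rintro x (hx | ⟨p, hp, hx⟩)
    · exact hDL x hx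
    · have hlock : Locks A L p.1 := by
        rcases List.prefix_or_prefix_of_prefix hp.isPrefix hPD with h | h
        · exact hbelow p hp.mem h (List.Subset.trans hnD hp.subset)
        · exact habove p.1 h fun y hy => hDL y (hp.isPrefix.subset hy)
      exact hlock.extent_subset hL hp.mem x hx
  · have hX : ∀ y ∈ x :: D, y ∈ L := List.forall_mem_cons.2 ⟨hx, hDL⟩
    have hconf (p : Claim) (hp : p ∈ allClaims A) (hpR : p.1 = R) : Confirmed A p :=
      Locks.confirmed hL hp (hpR ▸ hR)
    obtain ⟨p, hp, hpR, hXp⟩ := exists_claim_of_unblocked hA (sortedLT_of_isPrefix (hsort n) hRn)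
      hroot hconf (x :: D) fun y hy => ⟨hR.enumerated_eq.symm ▸ hX y hy, hor hRn (hX y hy)⟩
    rw [List.cons_subset] at hXp
    exact .inr ⟨p, ⟨hp, hpR ▸ hRn.trans hPD, hXp.2, hconf p hp hpR⟩, hXp.1⟩

end LimitLearning

/-! ### Effectivity of the new hypotheses and simulation of learners -/

/-- A projection of a primitive recursive relation is recursively enumerable. -/
theorem PrimrecRel.rePred_exists {α : Type*} [Primcodable α] {R : α → ℕ → Prop}
    (hR : PrimrecRel R) : REPred fun a => ∃ n, R a n := by
  classical
  have h : Partrec fun a => Nat.rfind fun n => Part.some (decide (R a n)) :=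
    Partrec.rfind hR.computablePred.decide.partrec
  exact h.dom_re.of_eq fun a => Nat.rfind_dom.trans
    ⟨fun ⟨n, hn, _⟩ => ⟨n, by simpa using hn⟩, fun ⟨n, hn⟩ => ⟨n, by simpa using hn,
      fun _ => trivial⟩⟩

namespace LimitLearning

open List Filter Nat.Partrec

/-- The number `x` is found by stage `s` in the set with the index which the learner with code `c`
outputs on `σ`. -/
def Approx (c : Code) (s : ℕ) (σ : List ℕ) (x : ℕ) : Prop :=
  ((c.evaln s (Gold (σ.map some))).bind fun e =>
    (Denumerable.ofNat Code e).evaln s x).isSome = true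

theorem primrecPred_approx (c : Code) :
    PrimrecPred fun q : ℕ × List ℕ × ℕ => Approx c q.1 q.2.1 q.2.2 := by
  refine Primrec.eq.comp (Primrec.option_isSome.comp (Primrec.option_bind ?_ ?_))
    (Primrec.const true)
  · refine Code.primrec_evaln.comp ((Primrec.fst.pair (Primrec.const c)).pair ?_)
    exact Primrec.encode.comp (Primrec.list_map (Primrec.fst.comp Primrec.snd)
      (Primrec.option_some.comp Primrec.snd).to₂)
  · exact Code.primrec_evaln.comp (((Primrec.fst.comp Primrec.fst).pair
      ((Primrec.ofNat Code).comp Primrec.snd)).pair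
      (Primrec.snd.comp (Primrec.snd.comp Primrec.fst)))

theorem approx_iff {c : Code} {s : ℕ} {σ : List ℕ} {x : ℕ} :
    Approx c s σ x ↔ ∃ e ∈ c.evaln s (Gold (σ.map some)),
      ∃ y, y ∈ (Denumerable.ofNat Code e).evaln s x := by
  simp only [Approx, Option.isSome_iff_exists, Option.bind_eq_some_iff, Option.mem_def]
  exact ⟨fun ⟨y, e, he, hy⟩ => ⟨e, he, y, hy⟩, fun ⟨e, he, y, hy⟩ => ⟨y, e, he, hy⟩⟩

theorem approx_mono (c : Code) (s t : ℕ) (σ : List ℕ) (x : ℕ) (h : s ≤ t) :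
    Approx c s σ x → Approx c t σ x := by
  simp only [approx_iff]
  exact fun ⟨e, he, y, hy⟩ => ⟨e, Code.evaln_mono h he, y, Code.evaln_mono h hy⟩

theorem enumerated_approx {c : Code} {σ : List ℕ} {e : ℕ} (he : e ∈ c.eval (Gold (σ.map some))) :
    enumerated (Approx c) σ = W e := by
  ext x
  simp only [enumerated, Set.mem_ofPred_eq, approx_iff, W, Part.dom_iff_mem]
  constructor
  · rintro ⟨s, e', he', y, hy⟩
    rw [Part.mem_unique he (Code.evaln_sound he')]
    exact ⟨y, Code.evaln_sound hy⟩
  · rintro ⟨y, hy⟩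
    obtain ⟨s, hs⟩ := Code.evaln_complete.1 he
    obtain ⟨t, ht⟩ := Code.evaln_complete.1 hy
    exact ⟨max s t, e, Code.evaln_mono (le_max_left s t) hs, y,
      Code.evaln_mono (le_max_right s t) ht⟩

theorem rePred_hypothesis {A : ℕ → List ℕ → ℕ → Prop}
    (hA : PrimrecPred fun q : ℕ × List ℕ × ℕ => A q.1 q.2.1 q.2.2)
    (hmono : ∀ s t σ x, s ≤ t → A s σ x → A t σ x) :
    REPred fun q : List ℕ × ℕ => q.2 ∈ hypothesis A q.1 := by
  -- One stage bounds both the search for a claim and its confirmation; monotonicity of `A` makes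
  -- this harmless.
  have hR : PrimrecRel fun (q : List ℕ × ℕ) (s : ℕ) => q.2 ∈ q.1 ∨ ∃ p ∈ claims A s,
      p.1 <+: q.1 ∧ q.1 ⊆ p.2 ∧ (∀ y ∈ p.2, A s p.1 y) ∧ q.2 ∈ p.2 := by
    have hD : Primrec fun r : (List ℕ × ℕ) × ℕ => r.1.1 := Primrec.fst.comp Primrec.fst
    have hx : Primrec fun r : (List ℕ × ℕ) × ℕ => r.1.2 := Primrec.snd.comp Primrec.fst
    refine (Primrec.list_mem hx hD).or (PrimrecPred.exists_mem_of_primrec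
      (f := fun r : (List ℕ × ℕ) × ℕ => claims A r.2)
      (p := fun r p => p.1 <+: r.1.1 ∧ r.1.1 ⊆ p.2 ∧ (∀ y ∈ p.2, A r.2 p.1 y) ∧ r.1.2 ∈ p.2)
      ((primrec_claims hA).comp Primrec.snd) ?_)
    have h1 : Primrec fun r : ((List ℕ × ℕ) × ℕ) × Claim => r.2.1 := Primrec.fst.comp Primrec.snd
    have h2 : Primrec fun r : ((List ℕ × ℕ) × ℕ) × Claim => r.2.2 := Primrec.snd.comp Primrec.snd
    refine (Primrec.list_prefix h1 (hD.comp Primrec.fst)).and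
      ((Primrec.list_subset (hD.comp Primrec.fst) h2).and
      (PrimrecPred.and ?_ (Primrec.list_mem (hx.comp Primrec.fst) h2)))
    exact PrimrecPred.forall_mem_of_primrec (f := fun r : ((List ℕ × ℕ) × ℕ) × Claim => r.2.2)
      (p := fun r y => A r.1.2 r.2.1 y) h2
      (hA.comp ((Primrec.snd.comp (Primrec.fst.comp Primrec.fst)).pair
        ((h1.comp Primrec.fst).pair Primrec.snd)))
  refine hR.rePred_exists.of_eq fun ⟨D, x⟩ => ?_
  constructor
  · rintro ⟨s, hx | ⟨p, hp, h1, h2, h3, h4⟩⟩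
    · exact .inl hx
    · exact .inr ⟨p, ⟨⟨s, hp⟩, h1, h2, fun y hy => ⟨s, h3 y hy⟩⟩, h4⟩
  · rintro (hx | ⟨p, ⟨⟨s, hp⟩, h1, h2, h3⟩, h4⟩)
    · exact ⟨0, .inl hx⟩
    · obtain ⟨t, ht, hst⟩ := ((eventually_forall_mem p.2 fun y hy =>
        eventually_of_exists hmono (h3 y hy)).and (eventually_ge_atTop s)).exists
      exact ⟨t, .inr ⟨p, claims_subset_of_le hst hp, h1, h2, ht, h4⟩⟩

/-- A uniformly recursively enumerable family of sets has computable indices. -/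
theorem exists_computable_index {p : List ℕ → Set ℕ}
    (hp : REPred fun q : List ℕ × ℕ => q.2 ∈ p q.1) :
    ∃ g : ℕ → ℕ, Computable g ∧ ∀ D, W (g (Encodable.encode D)) = p D := by
  have h : Partrec fun n : ℕ => (Part.assert (n.unpair.2 ∈ p (Denumerable.ofNat _ n.unpair.1))
      fun _ => Part.some ()).map fun _ => 0 := by
    refine Partrec.map ?_ (Computable.const 0).to₂
    exact Partrec.comp hp (((Computable.ofNat (List ℕ)).comp
      (Computable.fst.comp Computable.unpair)).pair (Computable.snd.comp Computable.unpair))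
  obtain ⟨c, hc⟩ := Code.exists_code.1 (Partrec.nat_iff.1 h)
  refine ⟨fun n => Encodable.encode (c.curry n),
    (Primrec.encode.comp (Code.primrec₂_curry.comp (Primrec.const c) Primrec.id)).to_comp,
    fun D => ?_⟩
  ext x
  simp [W, Code.eval_curry, hc, Part.assert]

@[simp]
theorem FinSeq.mem_content {σ : FinSeq} {x : ℕ} : x ∈ σ.content ↔ some x ∈ σ := by
  simp [FinSeq.content, List.reduceOption_mem_iff]

theorem Text.mem_content_initial {T : Text} {n x : ℕ} :
    x ∈ (T.initial n).content ↔ ∃ i < n, T i = some x := by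
  simp [Text.initial]

theorem sort_content_eq (σ : FinSeq) : σ.content.sort (· ≤ ·) = increasing σ.reduceOption :=
  σ.content.sortedLT_sort.eq_of_mem_iff (sortedLT_increasing _) fun x => by
    simp [List.reduceOption_mem_iff]

/-- A set-driven learner can be simulated by a Gold-style learner. -/
theorem exists_gold_simulation {h : ℕ →. ℕ} (hh : h ∈ PartialComputable) :
    ∃ h' ∈ PartialComputable, ∀ T : Text, interact Gold h' T = interact SetDriven h T := by
  refine ⟨fun n => h (Encodable.encode (increasing
    (Denumerable.ofNat (List (Option ℕ)) n).reduceOption)), ?_, fun T => ?_⟩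
  · refine Partrec.nat_iff.1 ((Partrec.nat_iff.2 hh).comp (Primrec.to_comp ?_))
    refine Primrec.encode.comp (primrec_increasing.comp ?_)
    exact Primrec.listFilterMap (Primrec.ofNat (List (Option ℕ))) Primrec.snd
  · funext n
    simp [interact, Gold, SetDriven, sort_content_eq]

theorem semConv_of_semWb {p : ℕ →. ℕ} {T : Text} : SemWb p T → SemConv p T := by
  rintro ⟨q, hq, h⟩
  refine ⟨q, hq, fun n m hnm hsub => by_contra fun hne => ?_⟩
  obtain ⟨x, ⟨hx, -⟩, hxn⟩ := h n m ⟨m, hnm.le, le_rfl, hne⟩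
  exact hxn (hsub hx)

end LimitLearning

/-! ### From behaviour on texts to hypotheses on lists, and back -/

namespace LimitLearning

open List Filter Nat.Partrec

open Classical in
/-- The text which starts with `σ` and then lists `L`. -/
noncomputable def textFrom (σ : List ℕ) (L : Set ℕ) : Text := fun i =>
  if h : i < σ.length then some σ[i] else
    if i - σ.length ∈ L then some (i - σ.length) else none

theorem content_textFrom {σ : List ℕ} {L : Set ℕ} (h : ∀ x ∈ σ, x ∈ L) :
    (textFrom σ L).content = L := by
  ext x
  simp only [Text.content, textFrom, Set.mem_ofPred_eq]
  constructor
  · rintro ⟨i, hi⟩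
    split_ifs at hi with h1 h2
    · exact Option.some.inj hi ▸ h _ (List.getElem_mem h1)
    · exact Option.some.inj hi ▸ h2
  · exact fun hx => ⟨σ.length + x, by simp [hx]⟩

theorem initial_textFrom {σ τ : List ℕ} (L : Set ℕ) (h : τ <+: σ) :
    (textFrom σ L).initial τ.length = τ.map some := by
  refine List.ext_getElem (by simp [Text.initial]) fun i h1 h2 => ?_
  have hi : i < τ.length := by simpa using h2
  simp [Text.initial, textFrom, hi.trans_le h.length_le, h.getElem hi]

theorem interact_eq_of_initial {h : ℕ →. ℕ} {c : Code} (hc : c.eval = h) {T : Text} {n : ℕ}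
    {σ : List ℕ} (hσ : T.initial n = σ.map some) {e : ℕ} (he : e ∈ interact Gold h T n) :
    enumerated (Approx c) σ = W e := by
  refine enumerated_approx ?_
  rw [hc, ← hσ]
  exact he

theorem initial_content_subset (T : Text) (n : ℕ) : ((T.initial n).content : Set ℕ) ⊆ T.content :=
  fun x hx => by
    obtain ⟨i, -, hi⟩ := Text.mem_content_initial.1 (Finset.mem_coe.1 hx)
    exact ⟨i, hi⟩

/-- Every list in `L` begins a text of `L`. A hypothesis covering `L` is never changed there, so it
equals the eventually correct one. -/
theorem conservativeOn_approx {h : ℕ →. ℕ} {c : Code} (hc : c.eval = h) {L : Set ℕ}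
    (hL : ∀ T : Text, T.content = L → Both SemConv Bc (interact Gold h T) T) :
    ConservativeOn (Approx c) L where
  enumerated_eq σ τ hστ hτ hsub := by
    obtain ⟨⟨q, hq, hcons⟩, -⟩ := hL _ (content_textFrom hτ)
    rw [interact_eq_of_initial hc (initial_textFrom L hστ) (hq _)] at hsub ⊢
    rw [interact_eq_of_initial hc (initial_textFrom L (List.prefix_refl τ)) (hq _)]
    rcases hστ.length_le.eq_or_lt with hlen | hlen
    · rw [hlen]
    · refine (hcons _ _ hlen fun x hx => hsub x ?_).symm
      rw [initial_textFrom L (List.prefix_refl τ)] at hx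
      simpa using hx
  eq_of_subset σ hσ hsub := by
    have hcont := content_textFrom hσ
    obtain ⟨⟨q, hq, hcons⟩, ⟨q', hq', n₀, hbc⟩⟩ := hL _ hcont
    rw [interact_eq_of_initial hc (initial_textFrom L (List.prefix_refl σ)) (hq _)] at hsub ⊢
    -- The position must be past `n₀` and strictly after `σ`, as conservativeness compares distinct
    -- positions.
    have hm := hcons σ.length (max n₀ (σ.length + 1)) (by omega)
      ((initial_content_subset _ _).trans (hcont.le.trans hsub))
    rw [hm, Part.mem_unique (hq _) (hq' _), hbc _ (le_max_left _ _), hcont]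

/-- The increasing list of the first `n` elements of an infinite set. -/
noncomputable def firstElements (L : Set ℕ) (n : ℕ) : List ℕ :=
  (List.range n).map (Nat.nth (· ∈ L))

theorem firstElements_isPrefix (L : Set ℕ) {m n : ℕ} (h : m ≤ n) :
    firstElements L m <+: firstElements L n := by
  obtain ⟨k, rfl⟩ := Nat.exists_eq_add_of_le h
  rw [firstElements, firstElements, List.range_add, List.map_append]
  exact List.prefix_append _ _

theorem sortedLT_firstElements {L : Set ℕ} (hL : L.Infinite) (n : ℕ) :
    (firstElements L n).SortedLT := by
  refine List.Pairwise.sortedLT (List.pairwise_map.2 ?_)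
  exact List.pairwise_lt_range.imp fun h => Nat.nth_strictMono hL h

theorem exists_nth_eq {L : Set ℕ} (hL : L.Infinite) {x : ℕ} :
    x ∈ L ↔ ∃ i, Nat.nth (· ∈ L) i = x := by
  have := Nat.range_nth_of_infinite (p := (· ∈ L)) hL
  exact (Set.ext_iff.1 this x).symm

theorem mem_iff_exists_mem_firstElements {L : Set ℕ} (hL : L.Infinite) {x : ℕ} :
    x ∈ L ↔ ∃ n, x ∈ firstElements L n := by
  rw [exists_nth_eq hL]
  simp only [firstElements, List.mem_map, List.mem_range]
  exact ⟨fun ⟨i, hi⟩ => ⟨i + 1, i, i.lt_succ_self, hi⟩, fun ⟨_, i, _, hi⟩ => ⟨i, hi⟩⟩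

theorem exists_enumerated_firstElements_eq {h : ℕ →. ℕ} {c : Code} (hc : c.eval = h) {L : Set ℕ}
    (hinf : L.Infinite) (hL : ∀ T : Text, T.content = L → Bc (interact Gold h T) T) :
    ∃ n, enumerated (Approx c) (firstElements L n) = L := by
  let T : Text := fun i => some (Nat.nth (· ∈ L) i)
  have hT : T.content = L := by
    ext x
    rw [exists_nth_eq hinf]
    simp [T, Text.content]
  obtain ⟨q, hq, n₀, hbc⟩ := hL T hT
  refine ⟨n₀, ?_⟩
  rw [interact_eq_of_initial (n := n₀) hc (by simp [T, Text.initial, firstElements]) (hq n₀),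
    hbc n₀ le_rfl, hT]

/-- The hypotheses which a set-driven learner makes on a text if they are given by a family of
sets on the increasing lists. -/
theorem exists_setDriven_learner {p : List ℕ → Set ℕ}
    (hp : REPred fun q : List ℕ × ℕ => q.2 ∈ p q.1) :
    ∃ h ∈ PartialComputable, ∀ T : Text, ∃ q : ℕ → ℕ, (∀ n, q n ∈ interact SetDriven h T n) ∧
      ∀ n, W (q n) = p ((T.initial n).content.sort (· ≤ ·)) := by
  obtain ⟨g, hg, hW⟩ := exists_computable_index hp
  exact ⟨fun n => Part.some (g n), Partrec.nat_iff.1 hg, fun T =>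
    ⟨fun n => g (SetDriven (T.initial n)), fun n => Part.mem_some _, fun n => hW _⟩⟩

theorem content_initial_mono (T : Text) {m n : ℕ} (h : m ≤ n) :
    (T.initial m).content ⊆ (T.initial n).content := fun x hx => by
  rw [Text.mem_content_initial] at hx ⊢
  exact hx.imp fun i hi => ⟨hi.1.trans_le h, hi.2⟩

theorem eventually_mem_content_initial {T : Text} {x : ℕ} (hx : x ∈ T.content) :
    ∀ᶠ n in atTop, x ∈ (T.initial n).content :=
  hx.elim fun i hi => (eventually_gt_atTop i).mono fun _ hn =>
    Text.mem_content_initial.2 ⟨i, hn, hi⟩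

theorem semWb_of_hypothesis {A : ℕ → List ℕ → ℕ → Prop} {p : ℕ →. ℕ} {T : Text} {q : ℕ → ℕ}
    (hq : ∀ n, q n ∈ p n)
    (hW : ∀ n, W (q n) = hypothesis A ((T.initial n).content.sort (· ≤ ·))) : SemWb p T := by
  refine ⟨q, hq, fun n m ⟨k, hnk, hkm, hne⟩ => ?_⟩
  by_contra hemp
  -- By consistency of the hypothesis at `m`, any datum outside the hypothesis at `n` would be a
  -- witness.
  have hsub : ∀ x ∈ (T.initial m).content, x ∈ W (q n) := fun x hx => by
    by_contra hxn
    refine hemp ⟨x, ⟨hx, ?_⟩, hxn⟩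
    rw [hW]
    exact subset_hypothesis ((Finset.mem_sort _).2 hx)
  refine hne ?_
  rw [hW n, hW k]
  refine (hypothesis_eq_of_subset (Finset.sortedLT_sort _) (Finset.sortedLT_sort _) ?_ ?_).symm
  · intro x hx
    rw [Finset.mem_sort] at hx ⊢
    exact content_initial_mono T hnk hx
  · intro x hx
    rw [← hW]
    exact hsub x (content_initial_mono T hkm ((Finset.mem_sort _).1 hx))

theorem bc_of_hypothesis {h : ℕ →. ℕ} {c : Code} (hc : c.eval = h) {L : Set ℕ}
    (hL : ∀ T : Text, T.content = L → Both SemConv Bc (interact Gold h T) T)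
    {p : ℕ →. ℕ} {T : Text} (hT : T.content = L) {q : ℕ → ℕ} (hq : ∀ n, q n ∈ p n)
    (hW : ∀ n, W (q n) = hypothesis (Approx c) ((T.initial n).content.sort (· ≤ ·))) :
    Bc p T := by
  have hcons := conservativeOn_approx hc hL
  have hsub (n : ℕ) : ∀ x ∈ (T.initial n).content.sort (· ≤ ·), x ∈ L := fun x hx =>
    hT ▸ initial_content_subset T n ((Finset.mem_sort _).1 hx)
  refine ⟨q, hq, ?_⟩
  simp only [hW, hT]
  rw [← eventually_atTop]
  by_cases hfin : L.Finite
  · filter_upwards [eventually_forall_mem hfin.toFinset.toList (Q := fun x n =>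
      x ∈ (T.initial n).content) fun x hx => eventually_mem_content_initial
        (hT.symm ▸ by simpa using hx)] with n hn
    refine hypothesis_eq_of_finite hcons fun x => ⟨hsub n x, fun hx => ?_⟩
    exact (Finset.mem_sort _).2 (hn x (by simpa using hx))
  · obtain ⟨n₀, h₀⟩ := exists_enumerated_firstElements_eq hc hfin fun T hT => (hL T hT).2
    obtain ⟨n, hn⟩ := exists_hypothesis_eq (approx_mono c) hcons hfin
      (fun _ _ h => firstElements_isPrefix L h) (sortedLT_firstElements hfin)
      (fun _ => mem_iff_exists_mem_firstElements hfin) h₀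
    filter_upwards [eventually_forall_mem (firstElements L n) (Q := fun x n =>
      x ∈ (T.initial n).content) fun x hx => eventually_mem_content_initial
        (hT.symm ▸ (mem_iff_exists_mem_firstElements hfin).2 ⟨n, hx⟩)] with m hm
    exact hn _ (Finset.sortedLT_sort _) (fun x hx => (Finset.mem_sort _).2 (hm x hx)) (hsub m)

end LimitLearning

theorem mainTheorem1 :
    LimitLearning.learningPower LimitLearning.SemWb LimitLearning.PartialComputable
        LimitLearning.SetDriven LimitLearning.Bc =
      LimitLearning.learningPower LimitLearning.NoRestriction LimitLearning.PartialComputable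
        LimitLearning.Gold (LimitLearning.Both LimitLearning.SemConv LimitLearning.Bc) := by
  open LimitLearning in
  refine Set.Subset.antisymm ?_ ?_
  · rintro 𝓛 ⟨h, hh, h𝓛⟩
    obtain ⟨h', hh', heq⟩ := exists_gold_simulation hh
    refine ⟨h', hh', fun L hL => ⟨(h𝓛 hL).1, fun _ => trivial, fun T hT => ?_⟩⟩
    rw [heq T]
    exact ⟨semConv_of_semWb ((h𝓛 hL).2.1 T), (h𝓛 hL).2.2 T hT⟩
  · rintro 𝓛 ⟨h, hh, h𝓛⟩
    obtain ⟨c, hc⟩ := Nat.Partrec.Code.exists_code.1 hh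
    obtain ⟨h', hh', hq⟩ := exists_setDriven_learner
      (rePred_hypothesis (primrecPred_approx c) (approx_mono c))
    refine ⟨h', hh', fun L hL => ⟨(h𝓛 hL).1, fun T => ?_, fun T hT => ?_⟩⟩
    · obtain ⟨q, hq, hW⟩ := hq T
      exact semWb_of_hypothesis hq hW
    · obtain ⟨q, hq, hW⟩ := hq T
      exact bc_of_hypothesis hc (h𝓛 hL).2.2 hT hq hW
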